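/- Let $p\ge 5$ be a prime. Let $B_j$ denote the Bernoulli numbers, $H_n=\sum_{i=1}^n \frac1i$ the harmonic numbers and $H_n^{(2)}=\sum_{i=1}^n\frac1{i^2}$ the generalized harmonic numbers of order $2$. For a $p$-adic integer $x$ and $i\ge 0$, let $(x)_i=[x]_i\in\{0,1,\dots,p-1\}$ denote the digits of its Hensel expansion $x=\sum_{i\ge 0}(x)_i\,p^i$. Put $$S=\sum_{\substack{1\le m\le p-1\\ m\ \mathrm{odd}}}H_m .$$ Then $S$ and both sides of the following congruence are $p$-adic integers, and $$\begin{aligned}\sum_{j=2}^{p-3}\frac{B_j}{2^j}\,B_{p-1-j}\equiv{}&-1+2\Big[\tfrac12\,(2S)_0\Big]_1+\Big[2\,(S)_0\Big]_1+6S+4\sum_{m=1}^{\frac{p-3}{2}}H_{2m}^{(2)}-4\sum_{m=1}^{\frac{p-3}{2}}H_{2m}H_{2m+1}-4S^2\\&+2\sum_{m=2}^{\frac{p-3}{2}}\Big(\frac{H_1}{2m-1}+\frac{H_2}{2m-2}+\dots+\frac{H_{2m-1}}{1}\Big)\pmod p .\end{aligned}$$ (For $p=5$ the last sum is empty.) 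-/

import Mathlib

/-- The generalized harmonic number `H_k^{(n)} = ∑_{i=1}^k 1 / i^n`. The ordinary harmonic number
`H_k` is Mathlib's `harmonic k`. -/
def genHarmonic (n k : ℕ) : ℚ := ∑ i ∈ Finset.Icc 1 k, 1 / (i : ℚ) ^ n

/-- The digit `(x)_i ∈ {0, …, p - 1}` in the Hensel expansion `x = ∑ i, (x)_i * p ^ i` of a
`p`-adic integer `x`. Here `x.appr (i + 1)` is the representative of `x` modulo `p ^ (i + 1)` in
`{0, …, p ^ (i + 1) - 1}`, whose leading base-`p` digit is `(x)_i`. -/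
noncomputable def henselDigit {p : ℕ} [Fact p.Prime] (x : ℤ_[p]) (i : ℕ) : ℕ :=
  x.appr (i + 1) / p ^ i

/-- The rational number `x` is a `p`-adic integer. -/
def IsPIntegral (p : ℕ) [Fact p.Prime] (x : ℚ) : Prop := ‖(x : ℚ_[p])‖ ≤ 1

open Classical in
/-- The digit `(x)_i` in the Hensel expansion of a rational `p`-adic integer `x`
(and `0` by convention if `x` is not a `p`-adic integer). -/
noncomputable def pDigit (p : ℕ) [Fact p.Prime] (x : ℚ) (i : ℕ) : ℕ :=
  if h : IsPIntegral p x then henselDigit (⟨(x : ℚ_[p]), h⟩ : ℤ_[p]) i else 0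

/-- Congruence modulo `p` of rational `p`-adic integers: both numbers are `p`-adic integers and
their difference is `p` times a `p`-adic integer. -/
def PCongr (p : ℕ) [Fact p.Prime] (x y : ℚ) : Prop :=
  IsPIntegral p x ∧ IsPIntegral p y ∧ ∃ r : ℚ, IsPIntegral p r ∧ x - y = (p : ℚ) * r

/-- The sum `∑ H_m` over the odd `m` with `1 ≤ m ≤ p - 1`. -/
def oddHarmonicSum (p : ℕ) : ℚ :=
  ∑ m ∈ (Finset.Icc 1 (p - 1)).filter (fun m => Odd m), harmonic m

/-! Write `p = 2N + 1` and let `q` be the sum of the reciprocals of the odd numbers below `p`, taken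
in `ZMod p`; it is the residue of the Fermat quotient of `2`. Both sides turn out to be `1 + q`.

Left side: with `g(x) = x/(e^x - 1)`, the product `g(x) g(2x)` is a combination of `g`, `g'` and
`g(2x)` (`bernoulliPowerSeries_mul_rescale_two`). This evaluates the sum weighted by `(p-1).choose
j`. The weight is `1` modulo `p` for even `j`, and the terms with odd `j` vanish. Splitting off the
two end terms leaves a multiple of `p * bernoulli (p - 1)`, which is `-1` modulo `p`.

Right side: the digit terms add up to `0` or `p`. The convolutions have a closed form
(`sum_harmonic_div_sub`), so the remaining sums collapse to `2T - 2`, where `T` sums `H_m^{(2)} -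
H_m^2` over odd `m`. Summation by parts and the reflection `i ↦ p - i` give `2S = 1 + q` and `2T =
q^2 + 2`; the latter needs the vanishing of a double sum (`sum_oddRecipSum_mul_eq_zero`). -/

/-- The rational number `x` is `p`-integral with residue `a` modulo `p`. -/
def ReducesTo (p : ℕ) [Fact p.Prime] (x : ℚ) (a : ZMod p) : Prop :=
  ∃ z : ℤ_[p], (z : ℚ_[p]) = x ∧ PadicInt.toZMod z = a

namespace ReducesTo

variable {p : ℕ} [Fact p.Prime] {x y : ℚ} {a b : ZMod p}

theorem isPIntegral (h : ReducesTo p x a) : IsPIntegral p x := by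
  obtain ⟨z, hz, -⟩ := h
  rw [IsPIntegral, ← hz]
  exact z.2

theorem add (hx : ReducesTo p x a) (hy : ReducesTo p y b) : ReducesTo p (x + y) (a + b) := by
  obtain ⟨z, hz, rfl⟩ := hx
  obtain ⟨w, hw, rfl⟩ := hy
  exact ⟨z + w, by simp [hz, hw], by simp⟩

theorem mul (hx : ReducesTo p x a) (hy : ReducesTo p y b) : ReducesTo p (x * y) (a * b) := by
  obtain ⟨z, hz, rfl⟩ := hx
  obtain ⟨w, hw, rfl⟩ := hy
  exact ⟨z * w, by simp [hz, hw], by simp⟩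

theorem neg (hx : ReducesTo p x a) : ReducesTo p (-x) (-a) := by
  obtain ⟨z, hz, rfl⟩ := hx
  exact ⟨-z, by simp [hz], by simp⟩

theorem sub (hx : ReducesTo p x a) (hy : ReducesTo p y b) : ReducesTo p (x - y) (a - b) := by
  simpa only [sub_eq_add_neg] using hx.add hy.neg

theorem natCast (n : ℕ) : ReducesTo p n n := ⟨n, by simp, by simp⟩

theorem zero : ReducesTo p 0 0 := by simpa using natCast (p := p) 0

theorem one : ReducesTo p 1 1 := by simpa using natCast (p := p) 1

theorem ofNat (n : ℕ) [n.AtLeastTwo] : ReducesTo p (OfNat.ofNat n) (OfNat.ofNat n) :=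
  natCast n

theorem pow (hx : ReducesTo p x a) (n : ℕ) : ReducesTo p (x ^ n) (a ^ n) := by
  obtain ⟨z, hz, rfl⟩ := hx
  exact ⟨z ^ n, by simp [hz], by simp⟩

theorem sum {ι : Type*} {s : Finset ι} {f : ι → ℚ} {g : ι → ZMod p}
    (h : ∀ i ∈ s, ReducesTo p (f i) (g i)) : ReducesTo p (∑ i ∈ s, f i) (∑ i ∈ s, g i) := by
  classical
  induction s using Finset.induction_on with
  | empty => simpa using zero
  | insert i s hi ih =>
    rw [Finset.sum_insert hi, Finset.sum_insert hi]
    exact (h i (by simp)).add (ih fun j hj => h j (by simp [hj]))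

theorem inv (hx : ReducesTo p x a) (ha : a ≠ 0) : ReducesTo p x⁻¹ a⁻¹ := by
  obtain ⟨z, hz, rfl⟩ := hx
  have hu : IsUnit z := by
    by_contra hu
    apply ha
    have : z ∈ IsLocalRing.maximalIdeal ℤ_[p] := hu
    rwa [← PadicInt.ker_toZMod, RingHom.mem_ker] at this
  obtain ⟨u, rfl⟩ := hu
  refine ⟨(u⁻¹ : ℤ_[p]ˣ), ?_, ?_⟩
  · have h1 : ((u : ℤ_[p]) : ℚ_[p]) * ((u⁻¹ : ℤ_[p]ˣ) : ℤ_[p]) = 1 := by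
      rw [← PadicInt.coe_mul]; simp
    rw [eq_comm, Rat.cast_inv, ← hz]
    exact inv_eq_of_mul_eq_one_right h1
  · rw [eq_comm]
    apply inv_eq_of_mul_eq_one_right
    rw [← map_mul]; simp

theorem div (hx : ReducesTo p x a) (hy : ReducesTo p y b) (hb : b ≠ 0) :
    ReducesTo p (x / y) (a / b) := by
  simpa only [div_eq_mul_inv] using hx.mul (hy.inv hb)

theorem exists_eq_mul (hx : ReducesTo p x 0) : ∃ r : ℚ, IsPIntegral p r ∧ x = p * r := by
  have hp : (p : ℚ) ≠ 0 := by exact_mod_cast (Fact.out : p.Prime).ne_zero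
  obtain ⟨z, hz, h0⟩ := hx
  rw [← RingHom.mem_ker, PadicInt.ker_toZMod, PadicInt.maximalIdeal_eq_span_p,
    Ideal.mem_span_singleton] at h0
  obtain ⟨w, rfl⟩ := h0
  have hp' : (p : ℚ_[p]) ≠ 0 := by exact_mod_cast (Fact.out : p.Prime).ne_zero
  refine ⟨x / p, ?_, by field_simp⟩
  have : ((x / p : ℚ) : ℚ_[p]) = w := by
    rw [Rat.cast_div, ← hz]
    simp [hp']
  rw [IsPIntegral, this]
  exact w.2

theorem of_isPIntegral (hx : IsPIntegral p x) : ∃ a, ReducesTo p x a :=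
  ⟨_, ⟨x, hx⟩, rfl, rfl⟩

theorem pCongr (hx : ReducesTo p x a) (hy : ReducesTo p y a) : PCongr p x y :=
  ⟨hx.isPIntegral, hy.isPIntegral, (by simpa using hx.sub hy : ReducesTo p (x - y) 0).exists_eq_mul⟩

end ReducesTo

/-! ### Hensel digits -/

theorem pDigit_eq_toZModPow_val {p : ℕ} [Fact p.Prime] {x : ℚ} {z : ℤ_[p]}
    (h : (z : ℚ_[p]) = x) (i : ℕ) :
    pDigit p x i = (PadicInt.toZModPow (i + 1) z).val / p ^ i := by
  have hx : IsPIntegral p x := by rw [IsPIntegral, ← h]; exact z.2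
  rw [pDigit, dif_pos hx]
  have hz : (⟨(x : ℚ_[p]), hx⟩ : ℤ_[p]) = z := Subtype.ext h.symm
  rw [hz, henselDigit]
  congr 1
  have : PadicInt.toZModPow (i + 1) z = (z.appr (i + 1) : ZMod (p ^ (i + 1))) := rfl
  rw [this, ZMod.val_natCast_of_lt (PadicInt.appr_lt _ _)]

theorem pDigit_natCast {p : ℕ} [Fact p.Prime] {n i : ℕ} (hn : n < p ^ (i + 1)) :
    pDigit p (n : ℚ) i = n / p ^ i := by
  rw [pDigit_eq_toZModPow_val (z := (n : ℤ_[p])) (by simp), map_natCast,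
    ZMod.val_natCast_of_lt hn]

/-- The digit of index `1` of half of an odd number below `p` is `(p - 1) / 2`. -/
theorem pDigit_half_odd {N b : ℕ} [Fact (2 * N + 1).Prime] (hb : b < N) :
    pDigit (2 * N + 1) (1 / 2 * ((2 * b + 1 : ℕ) : ℚ)) 1 = N := by
  have h2 : ((2 : ℕ) : ZMod (2 * N + 1)) ≠ 0 := by
    rw [Ne, ZMod.natCast_eq_zero_iff]
    intro h
    have := Nat.le_of_dvd (by norm_num) h
    omega
  obtain ⟨z, hz, -⟩ := (((ReducesTo.natCast 2).inv h2).mul (ReducesTo.natCast (2 * b + 1)))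
  rw [pDigit_eq_toZModPow_val (z := z) (by rw [hz]; norm_num)]
  have hz2 : 2 * z = ((2 * b + 1 : ℕ) : ℤ_[2 * N + 1]) := by
    apply PadicInt.ext
    have : ((2 * z : ℤ_[2 * N + 1]) : ℚ_[2 * N + 1]) = 2 * z := by push_cast; rfl
    rw [this, hz, Rat.cast_mul, Rat.cast_inv, Rat.cast_natCast, Rat.cast_natCast, Nat.cast_ofNat,
      mul_inv_cancel_left₀ two_ne_zero, PadicInt.coe_natCast]
  have hsq : (2 * N + 1) ^ (1 + 1) = 4 * (N * N) + 4 * N + 1 := by ring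
  -- The representative is `(2b + 1 + p^2)/2 = (b + 1 + N) + N * p`, and `b < N` prevents a carry
  -- from the lowest digit.
  have hlt : b + 1 + (2 * (N * N) + 2 * N) < (2 * N + 1) ^ (1 + 1) := by rw [hsq]; nlinarith
  have key : PadicInt.toZModPow (1 + 1) z =
      ((b + 1 + (2 * (N * N) + 2 * N) : ℕ) : ZMod ((2 * N + 1) ^ (1 + 1))) := by
    have e1 := congrArg (PadicInt.toZModPow (1 + 1)) hz2
    rw [map_mul, map_ofNat, map_natCast] at e1
    have hu : IsUnit ((2 : ℕ) : ZMod ((2 * N + 1) ^ (1 + 1))) := by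
      rw [ZMod.isUnit_iff_coprime]
      exact Nat.Coprime.pow_right _ (by simp)
    apply hu.mul_left_cancel
    rw [Nat.cast_ofNat, e1]
    have h0 : (((2 * N + 1) ^ (1 + 1) : ℕ) : ZMod ((2 * N + 1) ^ (1 + 1))) = 0 :=
      ZMod.natCast_self _
    push_cast at h0 ⊢
    linear_combination -h0
  rw [key, ZMod.val_natCast_of_lt hlt, pow_one]
  rw [Nat.div_eq_iff (by omega)]
  have hmul : N * (2 * N + 1) = 2 * (N * N) + N := by ring
  constructor <;> omega

/-- The digit terms of the congruence cancel modulo `p`. -/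
theorem digits_reducesTo_zero {N : ℕ} [Fact (2 * N + 1).Prime] {x : ℚ}
    (hx : IsPIntegral (2 * N + 1) x) :
    ReducesTo (2 * N + 1)
      (2 * (pDigit (2 * N + 1) (1 / 2 * (pDigit (2 * N + 1) (2 * x) 0 : ℚ)) 1 : ℚ)
        + (pDigit (2 * N + 1) (2 * (pDigit (2 * N + 1) x 0 : ℚ)) 1 : ℚ)) 0 := by
  obtain ⟨z, hz⟩ : ∃ z : ℤ_[2 * N + 1], (z : ℚ_[2 * N + 1]) = x := ⟨⟨x, hx⟩, rfl⟩
  have : NeZero ((2 * N + 1) ^ (0 + 1)) := ⟨by positivity⟩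
  have h2z : ((2 * z : ℤ_[2 * N + 1]) : ℚ_[2 * N + 1]) = ((2 * x : ℚ) : ℚ_[2 * N + 1]) := by
    push_cast; rw [hz]; rfl
  rw [pDigit_eq_toZModPow_val hz, pDigit_eq_toZModPow_val h2z, map_mul, map_ofNat]
  set u := PadicInt.toZModPow (0 + 1) z with hu
  obtain ⟨s, hs⟩ : ∃ s, u.val = s := ⟨_, rfl⟩
  have hslt : s < 2 * N + 1 := by
    have := ZMod.val_lt u
    rw [hs] at this; simpa using this
  have hus : u = (s : ZMod ((2 * N + 1) ^ (0 + 1))) := by rw [← hs, ZMod.natCast_zmod_val]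
  have h2u : (2 * u).val = (2 * s) % (2 * N + 1) := by
    rw [hus]
    have : (2 * (s : ZMod ((2 * N + 1) ^ (0 + 1)))) = ((2 * s : ℕ) : ZMod _) := by push_cast; rfl
    rw [this, ZMod.val_natCast]; simp
  rw [hs, h2u, pow_zero, Nat.div_one, Nat.div_one]
  have hd : (2 * (s : ℚ)) = ((2 * s : ℕ) : ℚ) := by push_cast; rfl
  have hp1 : 2 * s < (2 * N + 1) ^ (1 + 1) := by
    rw [show (2 * N + 1) ^ (1 + 1) = 4 * (N * N) + 4 * N + 1 by ring]
    nlinarith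
  rw [hd, pDigit_natCast hp1, pow_one]
  -- Doubling `s` carries exactly when `s > N`. Without a carry both digits are `0`; with one, `2s -
  -- p` is odd, so the terms are `2N` and `1`, with sum `p`.
  by_cases hlt : s ≤ N
  · rw [Nat.mod_eq_of_lt (by omega), Nat.div_eq_of_lt (show 2 * s < 2 * N + 1 by omega)]
    have : (1 / 2 * ((2 * s : ℕ) : ℚ)) = (s : ℚ) := by push_cast; ring
    rw [this, pDigit_natCast (by omega), Nat.div_eq_of_lt (by simpa using hslt)]
    simpa using ReducesTo.zero
  · obtain ⟨b, rfl⟩ : ∃ b, s = b + N + 1 := ⟨s - N - 1, by omega⟩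
    have h1 : 2 * (b + N + 1) % (2 * N + 1) = 2 * b + 1 := by
      rw [show 2 * (b + N + 1) = 2 * b + 1 + (2 * N + 1) by ring, Nat.add_mod_right,
        Nat.mod_eq_of_lt (by omega)]
    have h3 : 2 * (b + N + 1) / (2 * N + 1) = 1 := by
      rw [Nat.div_eq_iff (by omega)]; omega
    rw [h1, h3, pDigit_half_odd (by omega)]
    simpa using ReducesTo.natCast (p := 2 * N + 1) (2 * N + 1)

/-! ### Convolution of harmonic numbers -/

theorem sum_harmonic_div_sub (n : ℕ) :
    ∑ k ∈ Finset.range n, harmonic k / ((n : ℚ) - k) = harmonic n ^ 2 - genHarmonic 2 n := by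
  have gsucc (n : ℕ) : genHarmonic 2 (n + 1) = genHarmonic 2 n + 1 / ((n : ℚ) + 1) ^ 2 := by
    rw [genHarmonic, Finset.sum_Icc_succ_top (by omega), genHarmonic]; push_cast; rfl
  have hsum (n : ℕ) : harmonic n = ∑ k ∈ Finset.range n, 1 / ((k : ℚ) + 1) := by
    simp [harmonic]
  induction n with
  | zero => simp [genHarmonic]
  | succ n ih =>
    have hn : (n : ℚ) + 1 ≠ 0 := by positivity
    -- Shift the index, split `H_{k+1} = H_k + 1/(k+1)`, and expand `1/((k+1)(n-k))` in partial
    -- fractions; the new terms sum to `2 H_n/(n+1)`.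
    have e : ∀ k ∈ Finset.range n, harmonic (k + 1) / (((n + 1 : ℕ) : ℚ) - ((k + 1 : ℕ) : ℚ)) =
        harmonic k / ((n : ℚ) - k) + (1 / ((n : ℚ) + 1)) *
          (1 / ((k : ℚ) + 1) + 1 / (((n - 1 - k : ℕ) : ℚ) + 1)) := by
      intro k hk
      have hk := Finset.mem_range.1 hk
      have h1 : (n : ℚ) - k ≠ 0 := by
        rw [sub_ne_zero]; exact_mod_cast hk.ne'
      have h2 : (k : ℚ) + 1 ≠ 0 := by positivity
      have h3 : ((n - 1 - k : ℕ) : ℚ) + 1 = n - k := by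
        rw [Nat.sub_sub, Nat.cast_sub (by omega)]; push_cast; ring
      rw [h3, harmonic_succ]
      push_cast
      rw [show (n : ℚ) + 1 - (k + 1) = n - k by ring]
      field_simp
      ring
    rw [Finset.sum_range_succ', Finset.sum_congr rfl e, Finset.sum_add_distrib, ih,
      ← Finset.mul_sum, Finset.sum_add_distrib,
      Finset.sum_range_reflect (fun k => 1 / ((k : ℚ) + 1)) n, ← hsum, harmonic_zero, gsucc,
      harmonic_succ]
    push_cast
    field_simp
    ring

/-! ### Generating function of the Bernoulli products -/

open PowerSeries in
theorem bernoulliPowerSeries_mul_rescale_two :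
    bernoulliPowerSeries ℚ * rescale 2 (bernoulliPowerSeries ℚ) =
      bernoulliPowerSeries ℚ - X * derivative ℚ (bernoulliPowerSeries ℚ)
        - X * bernoulliPowerSeries ℚ - C (1 / 2) * X * rescale 2 (bernoulliPowerSeries ℚ) := by
  set g := bernoulliPowerSeries ℚ
  set E := exp ℚ with hE
  have hg : g * (E - 1) = X := bernoulliPowerSeries_mul_exp_sub_one ℚ
  have hC2 : (2 : ℚ⟦X⟧) = C 2 := (map_ofNat C 2).symm
  have hC : (2 : ℚ⟦X⟧) * C (1 / 2) = 1 := by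
    rw [hC2, ← map_mul]; norm_num
  have hG : rescale 2 g * (E ^ 2 - 1) = 2 * X := by
    have h := congrArg (rescale (2 : ℚ)) hg
    rw [map_mul, map_sub, map_one, rescale_X] at h
    rw [hC2, hE, exp_pow_eq_rescale_exp]
    exact_mod_cast h
  have hd : derivative ℚ g * (E - 1) + g * E = 1 := by
    have h := congrArg (derivative ℚ) hg
    rw [Derivation.leibniz] at h
    simp only [map_sub, smul_eq_mul, derivative_X] at h
    have h1 : derivative ℚ (1 : ℚ⟦X⟧) = 0 := Derivation.map_one_eq_zero _
    rw [h1, hE, derivative_exp, ← hE] at h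
    linear_combination h
  have hE1 : E - 1 ≠ 0 := by
    intro h; rw [h, mul_zero] at hg; exact X_ne_zero hg.symm
  have hE2 : E ^ 2 - 1 ≠ 0 := by
    intro h; rw [h, mul_zero] at hG
    exact mul_ne_zero (fun h2 => by simp [h2] at hC) X_ne_zero hG.symm
  -- Clearing the denominators `e^x - 1` and `e^{2x} - 1` leaves a polynomial identity in `X` and
  -- `E`, modulo the defining relations of `g(x)`, `g(2x)` and `g'`.
  apply mul_right_cancel₀ (mul_ne_zero hE1 hE2)
  linear_combination (rescale 2 g * (E ^ 2 - 1) - (E ^ 2 - 1) + X * (E ^ 2 - 1)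
    - X * E * (E + 1)) * hg + X * hG + X * (E ^ 2 - 1) * hd + C (1 / 2) * X * (E - 1) * hG
    + X ^ 2 * (E - 1) * hC

theorem sum_choose_mul_bernoulli_mul_bernoulli (m : ℕ) :
    ∑ j ∈ Finset.range (m + 2),
        ((m + 1).choose j : ℚ) * (bernoulli j / 2 ^ j * bernoulli (m + 1 - j)) =
      (-m * bernoulli (m + 1) - (m + 1) * (1 + 2 ^ m / 2) * bernoulli m) / 2 ^ (m + 1) := by
  have h := congrArg (PowerSeries.coeff (m + 1)) bernoulliPowerSeries_mul_rescale_two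
  have hc (k : ℕ) : PowerSeries.coeff k (bernoulliPowerSeries ℚ) =
      bernoulli k / (k.factorial : ℚ) := by simp [bernoulliPowerSeries]
  have hf (k : ℕ) : (k.factorial : ℚ) ≠ 0 := by exact_mod_cast k.factorial_ne_zero
  have hm : (m : ℚ) + 1 ≠ 0 := by positivity
  rw [PowerSeries.coeff_mul, Finset.Nat.sum_antidiagonal_eq_sum_range_succ_mk] at h
  simp only [map_sub, mul_assoc, PowerSeries.coeff_succ_X_mul, PowerSeries.coeff_C_mul,
    PowerSeries.coeff_rescale, PowerSeries.coeff_derivative, hc] at h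
  have e : ∀ j ∈ Finset.range (m + 2),
      ((m + 1).choose j : ℚ) * (bernoulli j / 2 ^ j * bernoulli (m + 1 - j)) =
      ((m + 1).factorial / 2 ^ (m + 1) : ℚ) * (bernoulli j / (j.factorial : ℚ) *
        (2 ^ (m + 1 - j) * (bernoulli (m + 1 - j) / ((m + 1 - j).factorial : ℚ)))) := by
    intro j hj
    have hj : j ≤ m + 1 := by have := Finset.mem_range.1 hj; omega
    have h1 := hf j
    have h2 := hf (m + 1 - j)
    rw [Nat.cast_choose ℚ hj, ← pow_sub_mul_pow (2 : ℚ) hj]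
    field_simp
  rw [Finset.sum_congr rfl e, ← Finset.mul_sum, h, Nat.factorial_succ]
  have h1 := hf m
  push_cast
  field_simp
  ring

/-! ### Reciprocal sums over odd and even numbers -/

/-- The sum `∑ 1 / (2 i + 1) ^ r` over `i < n`. -/
noncomputable def oddRecipSum (K : Type*) [Field K] (r n : ℕ) : K :=
  ∑ i ∈ Finset.range n, ((2 * i + 1 : K) ^ r)⁻¹

/-- The sum `∑ 1 / (2 i + 2) ^ r` over `i < n`. -/
noncomputable def evenRecipSum (K : Type*) [Field K] (r n : ℕ) : K :=
  ∑ i ∈ Finset.range n, ((2 * i + 2 : K) ^ r)⁻¹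

section RecipSum

variable {K : Type*} [Field K]

theorem oddRecipSum_succ (r n : ℕ) :
    oddRecipSum K r (n + 1) = oddRecipSum K r n + ((2 * n + 1 : K) ^ r)⁻¹ :=
  Finset.sum_range_succ _ _

theorem evenRecipSum_succ (r n : ℕ) :
    evenRecipSum K r (n + 1) = evenRecipSum K r n + ((2 * n + 2 : K) ^ r)⁻¹ :=
  Finset.sum_range_succ _ _

@[simp] theorem oddRecipSum_zero (r : ℕ) : oddRecipSum K r 0 = 0 := rfl

@[simp] theorem evenRecipSum_zero (r : ℕ) : evenRecipSum K r 0 = 0 := rfl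

variable {N : ℕ}

theorem sum_odd_harmonic (h2 : (2 : K) ≠ 0) (hodd : ∀ i < N, (2 * i + 1 : K) ≠ 0)
    (heven : ∀ i < N, (2 * i + 2 : K) ≠ 0) {n : ℕ} (hn : n ≤ N) :
    ∑ m ∈ Finset.range n, (oddRecipSum K 1 (m + 1) + evenRecipSum K 1 m) =
      n * (oddRecipSum K 1 n + evenRecipSum K 1 n) - n + oddRecipSum K 1 n / 2 := by
  induction n with
  | zero => simp
  | succ n ih =>
    have ho := hodd n (by omega)
    have he := heven n (by omega)
    -- With `u = 2n + 1` every denominator is `u`, `u + 1` or `2`, so the step is a rational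
    -- identity in `u`.
    obtain ⟨u, hu⟩ : ∃ u : K, 2 * n + 1 = u := ⟨_, rfl⟩
    have hu' : (2 * n + 2 : K) = u + 1 := by linear_combination hu
    have hn' : (n : K) = (u - 1) / 2 := by field_simp; linear_combination hu
    rw [hu] at ho
    rw [hu'] at he
    rw [Finset.sum_range_succ, ih (by omega), oddRecipSum_succ, evenRecipSum_succ]
    push_cast
    simp only [pow_one, hu, hu']
    rw [hn']
    field_simp
    ring

/-- Summation by parts leaves one mixed sum without a closed form; it is evaluated only later, when
`2N + 1 = 0` in `K`. -/
theorem sum_odd_harmonic_sq (h2 : (2 : K) ≠ 0) (hodd : ∀ i < N, (2 * i + 1 : K) ≠ 0)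
    (heven : ∀ i < N, (2 * i + 2 : K) ≠ 0) {n : ℕ} (hn : n ≤ N) :
    ∑ m ∈ Finset.range n, (oddRecipSum K 1 (m + 1) + evenRecipSum K 1 m) ^ 2 =
      n * (oddRecipSum K 1 n + evenRecipSum K 1 n) ^ 2
        - 2 * (n * (oddRecipSum K 1 n + evenRecipSum K 1 n) - n + oddRecipSum K 1 n / 2)
        + (oddRecipSum K 1 n - evenRecipSum K 1 n) / 2 + oddRecipSum K 1 n ^ 2 / 2
        + ∑ m ∈ Finset.range n, evenRecipSum K 1 m * (2 * m + 1 : K)⁻¹ := by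
  induction n with
  | zero => simp
  | succ n ih =>
    have ho := hodd n (by omega)
    have he := heven n (by omega)
    obtain ⟨u, hu⟩ : ∃ u : K, 2 * n + 1 = u := ⟨_, rfl⟩
    have hu' : (2 * n + 2 : K) = u + 1 := by linear_combination hu
    have hn' : (n : K) = (u - 1) / 2 := by field_simp; linear_combination hu
    rw [hu] at ho
    rw [hu'] at he
    rw [Finset.sum_range_succ, Finset.sum_range_succ, ih (by omega), oddRecipSum_succ,
      evenRecipSum_succ]
    push_cast
    simp only [pow_one, hu, hu']
    rw [hn']
    field_simp
    ring

theorem sum_odd_genHarmonic_two (h2 : (2 : K) ≠ 0) (hodd : ∀ i < N, (2 * i + 1 : K) ≠ 0)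
    (heven : ∀ i < N, (2 * i + 2 : K) ≠ 0) {n : ℕ} (hn : n ≤ N) :
    ∑ m ∈ Finset.range n, (oddRecipSum K 2 (m + 1) + evenRecipSum K 2 m) =
      n * (oddRecipSum K 2 n + evenRecipSum K 2 n)
        - (oddRecipSum K 1 n + evenRecipSum K 1 n) / 2 + oddRecipSum K 2 n / 2 := by
  induction n with
  | zero => simp
  | succ n ih =>
    have ho := hodd n (by omega)
    have he := heven n (by omega)
    obtain ⟨u, hu⟩ : ∃ u : K, 2 * n + 1 = u := ⟨_, rfl⟩
    have hu' : (2 * n + 2 : K) = u + 1 := by linear_combination hu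
    have hn' : (n : K) = (u - 1) / 2 := by field_simp; linear_combination hu
    rw [hu] at ho
    rw [hu'] at he
    rw [Finset.sum_range_succ, ih (by omega)]
    simp only [oddRecipSum_succ, evenRecipSum_succ]
    push_cast
    simp only [pow_one, hu, hu']
    rw [hn']
    field_simp
    ring

theorem cast_reflect (hN : (2 * N + 1 : K) = 0) {l : ℕ} (hl : l < N) :
    (2 * (N - 1 - l : ℕ) + 1 : K) = -(2 * l + 2) := by
  rw [Nat.sub_sub, Nat.cast_sub (by omega)]
  push_cast
  linear_combination hN

/-- The reflection `i ↦ p - i` exchanges odd and even numbers below `p` and changes the sign of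
each. -/
theorem oddRecipSum_eq_evenRecipSum (hN : (2 * N + 1 : K) = 0) (r : ℕ) :
    oddRecipSum K r N = (-1) ^ r * evenRecipSum K r N := by
  rw [oddRecipSum, evenRecipSum, ← Finset.sum_range_reflect, Finset.mul_sum]
  refine Finset.sum_congr rfl fun l hl => ?_
  rw [cast_reflect hN (Finset.mem_range.1 hl), neg_pow, mul_inv]
  congr 1
  rw [← inv_pow]; norm_num

theorem sum_evenRecipSum_mul_add_sum_oddRecipSum_mul (n : ℕ) :
    ∑ m ∈ Finset.range n, evenRecipSum K 1 m * (2 * m + 1 : K)⁻¹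
      + ∑ m ∈ Finset.range n, oddRecipSum K 1 (m + 1) * (2 * m + 2 : K)⁻¹ =
      oddRecipSum K 1 n * evenRecipSum K 1 n := by
  induction n with
  | zero => simp
  | succ n ih =>
    rw [Finset.sum_range_succ, Finset.sum_range_succ, oddRecipSum_succ,
      evenRecipSum_succ]
    simp only [pow_one]
    linear_combination ih

/-- The sum of `1/((2i+1)(2j+1))` over `i + j < N` is computed twice: partial fractions along the
diagonals give `2X`, and reflecting `i` gives `-X`. Hence `3X = 0`. -/
theorem sum_oddRecipSum_mul_eq_zero (hodd : ∀ i < N, (2 * i + 1 : K) ≠ 0)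
    (heven : ∀ i < N, (2 * i + 2 : K) ≠ 0) (hN : (2 * N + 1 : K) = 0) (h3 : (3 : K) ≠ 0) :
    ∑ m ∈ Finset.range N, oddRecipSum K 1 (m + 1) * (2 * m + 2 : K)⁻¹ = 0 := by
  set X := ∑ m ∈ Finset.range N, oddRecipSum K 1 (m + 1) * (2 * m + 2 : K)⁻¹ with hX
  have h1 : ∑ m ∈ Finset.range N, ∑ i ∈ Finset.range (m + 1),
      (2 * i + 1 : K)⁻¹ * (2 * (m - i : ℕ) + 1 : K)⁻¹ = 2 * X := by
    rw [hX, Finset.mul_sum]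
    refine Finset.sum_congr rfl fun m hm => ?_
    have hm := Finset.mem_range.1 hm
    have e : ∀ i ∈ Finset.range (m + 1), (2 * i + 1 : K)⁻¹ * (2 * (m - i : ℕ) + 1 : K)⁻¹ =
        (2 * m + 2 : K)⁻¹ * ((2 * i + 1 : K)⁻¹ + (2 * (m + 1 - 1 - i : ℕ) + 1 : K)⁻¹) := by
      intro i hi
      have hi := Finset.mem_range.1 hi
      have a1 := hodd i (by omega)
      have a2 := hodd (m - i) (by omega)
      have a3 := heven m hm
      rw [Nat.add_sub_cancel]
      have : (2 * m + 2 : K) = (2 * i + 1) + (2 * (m - i : ℕ) + 1) := by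
        rw [Nat.cast_sub (by omega)]; ring
      rw [this] at a3 ⊢
      field_simp
      ring
    rw [Finset.sum_congr rfl e, ← Finset.mul_sum, Finset.sum_add_distrib,
      Finset.sum_range_reflect (fun i : ℕ => (2 * i + 1 : K)⁻¹)]
    simp only [oddRecipSum, pow_one]
    ring
  have h2 : ∑ m ∈ Finset.range N, ∑ i ∈ Finset.range (m + 1),
      (2 * i + 1 : K)⁻¹ * (2 * (m - i : ℕ) + 1 : K)⁻¹ = -X := by
    rw [Finset.sum_range_diag_flip N
      (fun i j : ℕ => (2 * i + 1 : K)⁻¹ * (2 * j + 1 : K)⁻¹), ← Finset.sum_range_reflect, hX,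
      ← Finset.sum_neg_distrib]
    refine Finset.sum_congr rfl fun l hl => ?_
    have hl := Finset.mem_range.1 hl
    rw [← Finset.mul_sum, cast_reflect hN hl, show N - (N - 1 - l) = l + 1 by omega]
    simp only [oddRecipSum, pow_one, inv_neg]
    ring
  have : 3 * X = 0 := by linear_combination h2 - h1
  exact (mul_eq_zero.1 this).resolve_left h3

theorem two_mul_sum_odd_harmonic (h2 : (2 : K) ≠ 0) (hodd : ∀ i < N, (2 * i + 1 : K) ≠ 0)
    (heven : ∀ i < N, (2 * i + 2 : K) ≠ 0) (hN : (2 * N + 1 : K) = 0) :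
    2 * ∑ m ∈ Finset.range N, (oddRecipSum K 1 (m + 1) + evenRecipSum K 1 m) =
      1 + oddRecipSum K 1 N := by
  have hr := oddRecipSum_eq_evenRecipSum hN 1
  rw [sum_odd_harmonic h2 hodd heven le_rfl]
  field_simp
  linear_combination 2 * N * hr - hN

theorem two_mul_sum_odd_genHarmonic_sub_sq (h2 : (2 : K) ≠ 0)
    (hodd : ∀ i < N, (2 * i + 1 : K) ≠ 0) (heven : ∀ i < N, (2 * i + 2 : K) ≠ 0)
    (hN : (2 * N + 1 : K) = 0) (h3 : (3 : K) ≠ 0)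
    (hsq : oddRecipSum K 2 N + evenRecipSum K 2 N = 0) :
    2 * ∑ m ∈ Finset.range N, ((oddRecipSum K 2 (m + 1) + evenRecipSum K 2 m)
        - (oddRecipSum K 1 (m + 1) + evenRecipSum K 1 m) ^ 2) =
      oddRecipSum K 1 N ^ 2 + 2 := by
  have hr := oddRecipSum_eq_evenRecipSum hN 1
  have hr2 := oddRecipSum_eq_evenRecipSum hN 2
  have h0 : oddRecipSum K 2 N = 0 := by
    have : 2 * oddRecipSum K 2 N = 0 := by linear_combination hsq + hr2
    exact (mul_eq_zero.1 this).resolve_left h2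
  have hx := sum_evenRecipSum_mul_add_sum_oddRecipSum_mul (K := K) N
  rw [sum_oddRecipSum_mul_eq_zero hodd heven hN h3, add_zero] at hx
  have hB : evenRecipSum K 1 N = - oddRecipSum K 1 N := by linear_combination hr
  rw [Finset.sum_sub_distrib, sum_odd_genHarmonic_two h2 hodd heven le_rfl,
    sum_odd_harmonic_sq h2 hodd heven le_rfl, hx, hsq, hB, h0]
  field_simp
  linear_combination (-2) * hN

end RecipSum

theorem sum_range_two_mul {M : Type*} [AddCommMonoid M] (f : ℕ → M) (n : ℕ) :
    ∑ i ∈ Finset.range (2 * n), f i = ∑ i ∈ Finset.range n, (f (2 * i) + f (2 * i + 1)) := by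
  induction n with
  | zero => simp
  | succ n ih =>
    rw [Finset.sum_range_succ, ← ih, show 2 * (n + 1) = 2 * n + 1 + 1 by ring,
      Finset.sum_range_succ, Finset.sum_range_succ, add_assoc]

/-- Inversion permutes the field, so this is the power sum of squares, which vanishes because `2 < p
- 1`. -/
theorem oddRecipSum_two_add_evenRecipSum_two {N : ℕ} [Fact (2 * N + 1).Prime] (hN : 2 ≤ N) :
    oddRecipSum (ZMod (2 * N + 1)) 2 N + evenRecipSum (ZMod (2 * N + 1)) 2 N = 0 := by
  have h1 : ∑ x : ZMod (2 * N + 1), (x ^ 2)⁻¹ = 0 := by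
    rw [← FiniteField.sum_pow_lt_card_sub_one (ZMod (2 * N + 1)) 2 (by rw [ZMod.card]; omega)]
    exact Fintype.sum_equiv (Equiv.inv _) _ _ fun x => by simp
  have h2 : ∑ x : ZMod (2 * N + 1), (x ^ 2)⁻¹ =
      ∑ i ∈ Finset.range (2 * N + 1), ((i : ZMod (2 * N + 1)) ^ 2)⁻¹ := by
    rw [← Fin.sum_univ_eq_sum_range (fun i : ℕ => ((i : ZMod (2 * N + 1)) ^ 2)⁻¹)]
    refine Finset.sum_congr rfl fun x _ => ?_
    exact congrArg (fun y => (y ^ 2)⁻¹) (ZMod.natCast_zmod_val x).symm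
  rw [h2, Finset.sum_range_succ', sum_range_two_mul] at h1
  rw [oddRecipSum, evenRecipSum, ← Finset.sum_add_distrib, ← h1]
  rw [Nat.cast_zero, zero_pow two_ne_zero, inv_zero, add_zero]
  refine Finset.sum_congr rfl fun i _ => ?_
  push_cast
  ring_nf

/-! ### Bernoulli numbers modulo `p` -/

section PIntegrality

variable {p : ℕ} [Fact p.Prime]

theorem natCast_zmod_ne_zero {k : ℕ} (h0 : 0 < k) (hk : k < p) : (k : ZMod p) ≠ 0 := by
  rw [Ne, ZMod.natCast_eq_zero_iff]
  exact Nat.not_dvd_of_pos_of_lt h0 hk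

theorem choose_pred_cast_zmod {k : ℕ} (hk : k < p) : ((p - 1).choose k : ZMod p) = (-1) ^ k := by
  induction k with
  | zero => simp
  | succ k ih =>
    have hp := (Fact.out : p.Prime)
    have h := Nat.choose_succ_succ' (p - 1) k
    rw [Nat.sub_add_cancel hp.one_le] at h
    have h0 : (p.choose (k + 1) : ZMod p) = 0 := by
      rw [ZMod.natCast_eq_zero_iff]
      exact hp.dvd_choose_self (by omega) hk
    rw [h, Nat.cast_add, ih (by omega)] at h0
    rw [pow_succ]
    linear_combination h0

theorem bernoulli_isPIntegral {k : ℕ} (hk : k + 1 < p) : IsPIntegral p (bernoulli k) := by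
  induction k using Nat.strong_induction_on with
  | _ k ih =>
    have h := sum_bernoulli (k + 1)
    rw [Finset.sum_range_succ, Nat.choose_succ_self_right] at h
    have hi : ∀ i : Finset.range k, ∃ a, ReducesTo p (((k + 1).choose i : ℚ) * bernoulli i) a := by
      rintro ⟨i, hi⟩
      have hi := Finset.mem_range.1 hi
      obtain ⟨a, ha⟩ := ReducesTo.of_isPIntegral (ih i hi (by omega))
      exact ⟨_, (ReducesTo.natCast _).mul ha⟩
    choose g hg using hi
    have hs := ReducesTo.sum (s := Finset.univ) fun i _ => hg i
    rw [Finset.sum_coe_sort (Finset.range k) fun i => ((k + 1).choose i : ℚ) * bernoulli i] at hs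
    have hr : ∃ a, ReducesTo p (if k + 1 = 1 then (1 : ℚ) else 0) a := by
      split_ifs
      · exact ⟨_, ReducesTo.one⟩
      · exact ⟨_, ReducesTo.zero⟩
    obtain ⟨a, ha⟩ := hr
    have hk0 : ((k + 1 : ℕ) : ℚ) ≠ 0 := by positivity
    have hB : bernoulli k = ((if k + 1 = 1 then (1 : ℚ) else 0) -
        ∑ i ∈ Finset.range k, ((k + 1).choose i : ℚ) * bernoulli i) / ((k + 1 : ℕ) : ℚ) := by
      rw [← h]
      field_simp
      ring
    rw [hB]
    exact ((ha.sub hs).div (ReducesTo.natCast _)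
      (natCast_zmod_ne_zero (by omega) hk)).isPIntegral

/-- In the recurrence `∑_{i<p} (p.choose i) B_i = 0` the inner coefficients are divisible by `p` and
the inner `B_i` are `p`-integral, so only `1 + p B_{p-1}` survives. -/
theorem p_mul_bernoulli_reducesTo : ReducesTo p (p * bernoulli (p - 1)) (-1) := by
  have hp := (Fact.out : p.Prime)
  obtain ⟨n, rfl⟩ : ∃ n, p = n + 2 := ⟨p - 2, by have := hp.two_le; omega⟩
  have h := sum_bernoulli (n + 2)
  rw [if_neg (by omega), Finset.sum_range_succ, Finset.sum_range_succ',
    Nat.choose_succ_self_right] at h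
  have hs : ReducesTo (n + 2)
      (∑ i ∈ Finset.range n, ((n + 2).choose (i + 1) : ℚ) * bernoulli (i + 1))
      (∑ i ∈ Finset.range n, 0) := by
    refine ReducesTo.sum fun i hi => ?_
    have hi := Finset.mem_range.1 hi
    obtain ⟨a, ha⟩ := ReducesTo.of_isPIntegral
      (bernoulli_isPIntegral (p := n + 2) (k := i + 1) (by omega))
    have h0 : ((n + 2).choose (i + 1) : ZMod (n + 2)) = 0 := by
      rw [ZMod.natCast_eq_zero_iff]
      exact hp.dvd_choose_self (by omega) (by omega)
    have := (ReducesTo.natCast (p := n + 2) ((n + 2).choose (i + 1))).mul ha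
    rwa [h0, zero_mul] at this
  have hB : ((n + 2 : ℕ) : ℚ) * bernoulli (n + 2 - 1) =
      -(∑ i ∈ Finset.range n, ((n + 2).choose (i + 1) : ℚ) * bernoulli (i + 1)) - 1 := by
    rw [show n + 2 - 1 = n + 1 by omega]
    rw [Nat.choose_zero_right, bernoulli_zero] at h
    push_cast at h ⊢
    linear_combination h
  rw [hB]
  have := hs.neg.sub ReducesTo.one
  rwa [Finset.sum_const_zero, neg_zero, zero_sub] at this

end PIntegrality

/-! ### The Fermat quotient and the Bernoulli sum -/

section Odd

variable {N : ℕ} [Fact (2 * N + 1).Prime]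

theorem zmod_odd_ne_zero {i : ℕ} (hi : i < N) : (2 * i + 1 : ZMod (2 * N + 1)) ≠ 0 := by
  exact_mod_cast natCast_zmod_ne_zero (p := 2 * N + 1) (k := 2 * i + 1) (by omega) (by omega)

theorem zmod_even_ne_zero {i : ℕ} (hi : i < N) : (2 * i + 2 : ZMod (2 * N + 1)) ≠ 0 := by
  exact_mod_cast natCast_zmod_ne_zero (p := 2 * N + 1) (k := 2 * i + 2) (by omega) (by omega)

theorem zmod_two_mul_add_one : (2 * N + 1 : ZMod (2 * N + 1)) = 0 := by
  exact_mod_cast ZMod.natCast_self (2 * N + 1)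

theorem zmod_two_ne_zero : (2 : ZMod (2 * N + 1)) ≠ 0 := by
  have hp := (Fact.out : (2 * N + 1).Prime).two_le
  exact_mod_cast natCast_zmod_ne_zero (p := 2 * N + 1) (k := 2) (by omega) (by omega)

/-- The Fermat quotient of `2`, expressed by the reciprocals of odd numbers. -/
theorem fermatQuotient_two_reducesTo :
    ReducesTo (2 * N + 1) (((2 : ℚ) ^ (2 * N) - 1) / ((2 * N + 1 : ℕ) : ℚ))
      (oddRecipSum (ZMod (2 * N + 1)) 1 N) := by
  -- Expand `2^p - 2` in binomial coefficients and divide by `p` via `p.choose (k+1) = p *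
  -- (p-1).choose k / (k+1)`.
  have hq : ((2 : ℚ) ^ (2 * N) - 1) / ((2 * N + 1 : ℕ) : ℚ) =
      (∑ k ∈ Finset.range (2 * N), ((2 * N).choose k : ℚ) / ((k + 1 : ℕ) : ℚ)) / 2 := by
    have h := congrArg (Nat.cast (R := ℚ)) (Nat.sum_range_choose (2 * N + 1))
    rw [Finset.sum_range_succ, Finset.sum_range_succ', Nat.choose_self, Nat.choose_zero_right] at h
    push_cast at h
    have e : ∀ k ∈ Finset.range (2 * N), ((2 * N + 1).choose (k + 1) : ℚ) =
        ((2 * N + 1 : ℕ) : ℚ) * (((2 * N).choose k : ℚ) / ((k + 1 : ℕ) : ℚ)) := by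
      intro k _
      have h1 : ((2 * N + 1 : ℕ) : ℚ) * ((2 * N).choose k : ℚ) =
          ((2 * N + 1).choose (k + 1) : ℚ) * ((k + 1 : ℕ) : ℚ) := by
        exact_mod_cast Nat.add_one_mul_choose_eq (2 * N) k
      have h2 : ((k + 1 : ℕ) : ℚ) ≠ 0 := by positivity
      rw [← mul_div_assoc, h1, mul_div_assoc, div_self h2, mul_one]
    rw [Finset.sum_congr rfl e, ← Finset.mul_sum, pow_succ] at h
    have h3 : ((2 * N + 1 : ℕ) : ℚ) ≠ 0 := by positivity
    rw [div_eq_iff h3]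
    linear_combination (-1 / 2) * h
  have hs : ReducesTo (2 * N + 1)
      (∑ k ∈ Finset.range (2 * N), ((2 * N).choose k : ℚ) / ((k + 1 : ℕ) : ℚ))
      (∑ k ∈ Finset.range (2 * N), (-1) ^ k / ((k + 1 : ℕ) : ZMod (2 * N + 1))) := by
    refine ReducesTo.sum fun k hk => ?_
    have hk := Finset.mem_range.1 hk
    have hc := choose_pred_cast_zmod (p := 2 * N + 1) (k := k) (by omega)
    rw [Nat.add_sub_cancel] at hc
    rw [← hc]
    exact (ReducesTo.natCast _).div (ReducesTo.natCast _)
      (natCast_zmod_ne_zero (by omega) (by omega))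
  have ht : ∑ k ∈ Finset.range (2 * N), (-1) ^ k / ((k + 1 : ℕ) : ZMod (2 * N + 1)) =
      oddRecipSum (ZMod (2 * N + 1)) 1 N - evenRecipSum (ZMod (2 * N + 1)) 1 N := by
    rw [sum_range_two_mul, oddRecipSum, evenRecipSum, ← Finset.sum_sub_distrib]
    refine Finset.sum_congr rfl fun i _ => ?_
    rw [pow_succ, pow_mul]
    push_cast
    ring
  have hr := oddRecipSum_eq_evenRecipSum (zmod_two_mul_add_one (N := N)) 1
  have hfin : (oddRecipSum (ZMod (2 * N + 1)) 1 N - evenRecipSum (ZMod (2 * N + 1)) 1 N) / 2 =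
      oddRecipSum (ZMod (2 * N + 1)) 1 N := by
    rw [div_eq_iff zmod_two_ne_zero]
    linear_combination -hr
  rw [hq, ← hfin, ← ht]
  exact hs.div (ReducesTo.ofNat 2) zmod_two_ne_zero

theorem sum_bernoulli_mul_bernoulli_reducesTo (hN : 2 ≤ N) :
    ReducesTo (2 * N + 1)
      (∑ j ∈ Finset.Icc 2 (2 * N - 2), bernoulli j / 2 ^ j * bernoulli (2 * N - j))
      (1 + oddRecipSum (ZMod (2 * N + 1)) 1 N) := by
  have h20 : (2 : ZMod (2 * N + 1)) ≠ 0 := zmod_two_ne_zero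
  have hp0 : ((2 * N + 1 : ℕ) : ℚ) ≠ 0 := by positivity
  -- The terms `j = 0` and `j = 2N` involve the non-integral `B_{p-1}`, so they are removed before
  -- reduction. Their coefficients combine with `-(2N - 1)` to `-(p + 2^{2N} - 1)`, a multiple of
  -- `p` after division by which the Fermat quotient appears.
  have hexact : ∑ j ∈ Finset.Icc 2 (2 * N - 2),
        ((2 * N).choose j : ℚ) * (bernoulli j / 2 ^ j * bernoulli (2 * N - j)) =
      -(((2 * N + 1 : ℕ) : ℚ) * bernoulli (2 * N + 1 - 1)) *
        (((2 : ℚ) ^ (2 * N) - 1) / ((2 * N + 1 : ℕ) : ℚ) + 1) / 2 ^ (2 * N) := by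
    obtain ⟨M, rfl⟩ : ∃ M, N = M + 2 := ⟨N - 2, by omega⟩
    have h := sum_choose_mul_bernoulli_mul_bernoulli (2 * M + 3)
    have hodd : bernoulli (2 * M + 3) = 0 := bernoulli_eq_zero_of_odd ⟨M + 1, by ring⟩ (by omega)
    rw [Finset.sum_range_succ, Finset.sum_range_succ, Finset.range_eq_Ico,
      Finset.sum_eq_sum_Ico_succ_bot (by omega), Finset.sum_eq_sum_Ico_succ_bot (by omega)] at h
    rw [show 2 * (M + 2) - 2 = 2 * M + 2 by omega, show 2 * (M + 2) = 2 * M + 3 + 1 by ring]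
    have hI : Finset.Icc 2 (2 * M + 2) = Finset.Ico (0 + 1 + 1) (2 * M + 3) := by
      ext x; simp only [Finset.mem_Icc, Finset.mem_Ico]; omega
    rw [hI]
    simp only [hodd, Nat.sub_zero, bernoulli_zero, Nat.choose_zero_right, Nat.choose_self,
      Nat.sub_self, pow_zero, zero_add, Nat.add_sub_cancel, mul_zero, zero_div, zero_mul] at h ⊢
    push_cast at h ⊢
    field_simp at h ⊢
    linear_combination h
  have key : ReducesTo (2 * N + 1)
      (∑ j ∈ Finset.Icc 2 (2 * N - 2),
        ((2 * N).choose j : ℚ) * (bernoulli j / 2 ^ j * bernoulli (2 * N - j)))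
      (1 + oddRecipSum (ZMod (2 * N + 1)) 1 N) := by
    rw [hexact]
    have h := ((p_mul_bernoulli_reducesTo (p := 2 * N + 1)).neg.mul
      (fermatQuotient_two_reducesTo.add ReducesTo.one)).div
        ((ReducesTo.ofNat 2).pow (2 * N)) (pow_ne_zero _ h20)
    have hf : (2 : ZMod (2 * N + 1)) ^ (2 * N) = 1 := by
      simpa using ZMod.pow_card_sub_one_eq_one h20
    rw [hf, neg_neg, one_mul, div_one] at h
    rw [add_comm (1 : ZMod (2 * N + 1))]
    exact h
  have hdiff : ReducesTo (2 * N + 1)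
      (∑ j ∈ Finset.Icc 2 (2 * N - 2), (bernoulli j / 2 ^ j * bernoulli (2 * N - j)
        - ((2 * N).choose j : ℚ) * (bernoulli j / 2 ^ j * bernoulli (2 * N - j))))
      (∑ j ∈ Finset.Icc 2 (2 * N - 2), 0) := by
    refine ReducesTo.sum fun j hj => ?_
    have hj := Finset.mem_Icc.1 hj
    rcases Nat.even_or_odd j with he | ho
    · obtain ⟨a, ha⟩ := ReducesTo.of_isPIntegral
        (bernoulli_isPIntegral (p := 2 * N + 1) (k := j) (by omega))
      obtain ⟨b, hb⟩ := ReducesTo.of_isPIntegral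
        (bernoulli_isPIntegral (p := 2 * N + 1) (k := 2 * N - j) (by omega))
      have ht := (ha.div ((ReducesTo.ofNat 2).pow j) (pow_ne_zero j h20)).mul hb
      have hc := choose_pred_cast_zmod (p := 2 * N + 1) (k := j) (by omega)
      rw [Nat.add_sub_cancel, he.neg_one_pow] at hc
      have := ht.sub ((ReducesTo.natCast ((2 * N).choose j)).mul ht)
      rwa [hc, one_mul, sub_self] at this
    · rw [bernoulli_eq_zero_of_odd ho (by omega)]
      simpa using ReducesTo.zero
  have := hdiff.add key
  rwa [Finset.sum_sub_distrib, sub_add_cancel, Finset.sum_const_zero, zero_add] at this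

end Odd

/-! ### Harmonic sums and the conclusion -/

theorem genHarmonic_succ (r n : ℕ) :
    genHarmonic r (n + 1) = genHarmonic r n + 1 / ((n + 1 : ℕ) : ℚ) ^ r := by
  rw [genHarmonic, Finset.sum_Icc_succ_top (by omega), genHarmonic]

theorem harmonic_eq_genHarmonic (n : ℕ) : harmonic n = genHarmonic 1 n := by
  induction n with
  | zero => simp [genHarmonic]
  | succ n ih => rw [harmonic_succ, genHarmonic_succ, ih, pow_one, one_div]

theorem genHarmonic_even_reducesTo {N : ℕ} [Fact (2 * N + 1).Prime] (r : ℕ) {m : ℕ} (hm : m ≤ N) :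
    ReducesTo (2 * N + 1) (genHarmonic r (2 * m))
      (oddRecipSum (ZMod (2 * N + 1)) r m + evenRecipSum (ZMod (2 * N + 1)) r m) := by
  have hinv {k : ℕ} (h0 : 0 < k) (hk : k < 2 * N + 1) :
      ReducesTo (2 * N + 1) (1 / (k : ℚ) ^ r) ((k : ZMod (2 * N + 1)) ^ r)⁻¹ := by
    rw [one_div]
    exact ((ReducesTo.natCast k).pow r).inv (pow_ne_zero _ (natCast_zmod_ne_zero h0 hk))
  induction m with
  | zero => simpa [genHarmonic] using ReducesTo.zero
  | succ m ih =>
    have h := ((ih (by omega)).add (hinv (k := 2 * m + 1) (by omega) (by omega))).add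
      (hinv (k := 2 * m + 2) (by omega) (by omega))
    rw [show 2 * (m + 1) = 2 * m + 1 + 1 by ring, genHarmonic_succ, genHarmonic_succ,
      oddRecipSum_succ, evenRecipSum_succ]
    push_cast at h ⊢
    convert h using 1
    · ring
    · ring

theorem genHarmonic_odd_reducesTo {N : ℕ} [Fact (2 * N + 1).Prime] (r : ℕ) {m : ℕ} (hm : m < N) :
    ReducesTo (2 * N + 1) (genHarmonic r (2 * m + 1))
      (oddRecipSum (ZMod (2 * N + 1)) r (m + 1) + evenRecipSum (ZMod (2 * N + 1)) r m) := by
  have h := (genHarmonic_even_reducesTo r hm.le).add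
    (((ReducesTo.natCast (2 * m + 1)).pow r).inv (pow_ne_zero r
      (natCast_zmod_ne_zero (p := 2 * N + 1) (k := 2 * m + 1) (by omega) (by omega))))
  rw [genHarmonic_succ, oddRecipSum_succ, one_div]
  push_cast at h ⊢
  convert h using 1
  ring

theorem oddHarmonicSum_eq (N : ℕ) :
    oddHarmonicSum (2 * N + 1) = ∑ m ∈ Finset.range N, genHarmonic 1 (2 * m + 1) := by
  rw [oddHarmonicSum, Finset.sum_filter, Nat.add_sub_cancel,
    show Finset.Icc 1 (2 * N) = Finset.Ico 1 (2 * N + 1) by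
      ext x; simp only [Finset.mem_Icc, Finset.mem_Ico]; omega,
    Finset.sum_Ico_eq_sum_range, Nat.add_sub_cancel, sum_range_two_mul]
  refine Finset.sum_congr rfl fun i _ => ?_
  rw [if_pos ⟨i, by ring⟩, if_neg (by rw [Nat.not_odd_iff_even]; exact ⟨i + 1, by ring⟩), add_zero,
    harmonic_eq_genHarmonic, add_comm]

theorem sum_Icc_harmonic_div_sub (m : ℕ) :
    ∑ k ∈ Finset.Icc 1 (2 * m - 1), harmonic k / ((2 * m : ℚ) - (k : ℚ)) =
      harmonic (2 * m) ^ 2 - genHarmonic 2 (2 * m) := by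
  rw [← sum_harmonic_div_sub]
  push_cast
  refine Finset.sum_subset ?_ ?_
  · intro k hk
    have := Finset.mem_Icc.1 hk
    exact Finset.mem_range.2 (by omega)
  · intro k hk hk'
    rw [Finset.mem_range] at hk
    rw [Finset.mem_Icc] at hk'
    obtain rfl : k = 0 := by omega
    simp

/-- With `H_{2m+1} = H_{2m} + 1/(2m+1)` both sides agree term by term. The `-2` accounts for `m =
1`, absent from the convolution sum, where `H_2^2 - H_2^{(2)} = 1`. -/
theorem harmonic_sums_eq {M : ℕ} (hM : 1 ≤ M) :
    4 * ∑ m ∈ Finset.Icc 1 M, genHarmonic 2 (2 * m)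
        - 4 * ∑ m ∈ Finset.Icc 1 M, harmonic (2 * m) * harmonic (2 * m + 1)
        + 2 * ∑ m ∈ Finset.Icc 2 M, ∑ k ∈ Finset.Icc 1 (2 * m - 1),
            harmonic k / ((2 * m : ℚ) - (k : ℚ)) =
      2 * ∑ m ∈ Finset.range (M + 1),
        (genHarmonic 2 (2 * m + 1) - genHarmonic 1 (2 * m + 1) ^ 2) - 2 := by
  simp only [sum_Icc_harmonic_div_sub]
  have hI (a : ℕ) : Finset.Icc a M = Finset.Ico a (M + 1) := by
    ext x; simp only [Finset.mem_Icc, Finset.mem_Ico]; omega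
  have h1 : ∑ m ∈ Finset.Icc 2 M, (harmonic (2 * m) ^ 2 - genHarmonic 2 (2 * m)) =
      ∑ m ∈ Finset.Icc 1 M, (harmonic (2 * m) ^ 2 - genHarmonic 2 (2 * m)) - 1 := by
    rw [hI, hI, Finset.sum_eq_sum_Ico_succ_bot (a := 1) (by omega)]
    have : harmonic (2 * 1) ^ 2 - genHarmonic 2 (2 * 1) = 1 := by
      rw [harmonic_eq_genHarmonic]
      norm_num [genHarmonic_succ, show genHarmonic 1 0 = 0 from rfl,
        show genHarmonic 2 0 = 0 from rfl]
    rw [this]; ring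
  have h2 : ∑ m ∈ Finset.range (M + 1),
        (genHarmonic 2 (2 * m + 1) - genHarmonic 1 (2 * m + 1) ^ 2) =
      ∑ m ∈ Finset.Icc 1 M, (genHarmonic 2 (2 * m + 1) - genHarmonic 1 (2 * m + 1) ^ 2) := by
    rw [Finset.range_eq_Ico, Finset.sum_eq_sum_Ico_succ_bot (by omega), hI]
    have : genHarmonic 2 (2 * 0 + 1) - genHarmonic 1 (2 * 0 + 1) ^ 2 = 0 := by
      norm_num [genHarmonic_succ, show genHarmonic 1 0 = 0 from rfl,
        show genHarmonic 2 0 = 0 from rfl]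
    rw [this, zero_add]
  rw [h1, h2, mul_sub 2, Finset.mul_sum, Finset.mul_sum, Finset.mul_sum, Finset.mul_sum,
    ← add_sub_assoc, ← Finset.sum_sub_distrib, ← Finset.sum_add_distrib, mul_one]
  congr 1
  refine Finset.sum_congr rfl fun m _ => ?_
  have h0 : ((2 * m + 1 : ℕ) : ℚ) ≠ 0 := by positivity
  rw [harmonic_eq_genHarmonic, harmonic_eq_genHarmonic, genHarmonic_succ, genHarmonic_succ, pow_one]
  field_simp
  ring

theorem theorem1 (p : ℕ) [Fact p.Prime] (hp : 5 ≤ p) :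
    IsPIntegral p (oddHarmonicSum p) ∧
    PCongr p
      (∑ j ∈ Finset.Icc 2 (p - 3), bernoulli j / 2 ^ j * bernoulli (p - 1 - j))
      (-1
        + 2 * (pDigit p (1 / 2 * (pDigit p (2 * oddHarmonicSum p) 0 : ℚ)) 1 : ℚ)
        + (pDigit p (2 * (pDigit p (oddHarmonicSum p) 0 : ℚ)) 1 : ℚ)
        + 6 * oddHarmonicSum p
        + 4 * ∑ m ∈ Finset.Icc 1 ((p - 3) / 2), genHarmonic 2 (2 * m)
        - 4 * ∑ m ∈ Finset.Icc 1 ((p - 3) / 2), harmonic (2 * m) * harmonic (2 * m + 1)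
        - 4 * oddHarmonicSum p ^ 2
        + 2 * ∑ m ∈ Finset.Icc 2 ((p - 3) / 2), ∑ k ∈ Finset.Icc 1 (2 * m - 1),
            harmonic k / ((2 * m : ℚ) - (k : ℚ))) := by
  obtain ⟨N, rfl⟩ : Odd p := (Fact.out : p.Prime).odd_of_ne_two (by omega)
  have hN : 2 ≤ N := by omega
  set K := ZMod (2 * N + 1)
  set q := oddRecipSum K 1 N with hq
  have hodd : ∀ i < N, (2 * i + 1 : K) ≠ 0 := fun i hi => zmod_odd_ne_zero hi
  have heven : ∀ i < N, (2 * i + 2 : K) ≠ 0 := fun i hi => zmod_even_ne_zero hi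
  have h2 : (2 : K) ≠ 0 := zmod_two_ne_zero
  have h3 : (3 : K) ≠ 0 := by
    exact_mod_cast natCast_zmod_ne_zero (p := 2 * N + 1) (k := 3) (by omega) (by omega)
  have hN0 : (2 * N + 1 : K) = 0 := zmod_two_mul_add_one
  have hS : ReducesTo (2 * N + 1) (oddHarmonicSum (2 * N + 1))
      (∑ m ∈ Finset.range N, (oddRecipSum K 1 (m + 1) + evenRecipSum K 1 m)) := by
    rw [oddHarmonicSum_eq]
    exact ReducesTo.sum fun m hm => genHarmonic_odd_reducesTo 1 (Finset.mem_range.1 hm)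
  have hT : ReducesTo (2 * N + 1)
      (∑ m ∈ Finset.range N, (genHarmonic 2 (2 * m + 1) - genHarmonic 1 (2 * m + 1) ^ 2))
      (∑ m ∈ Finset.range N, ((oddRecipSum K 2 (m + 1) + evenRecipSum K 2 m)
        - (oddRecipSum K 1 (m + 1) + evenRecipSum K 1 m) ^ 2)) :=
    ReducesTo.sum fun m hm => (genHarmonic_odd_reducesTo 2 (Finset.mem_range.1 hm)).sub
      ((genHarmonic_odd_reducesTo 1 (Finset.mem_range.1 hm)).pow 2)
  have eS := two_mul_sum_odd_harmonic h2 hodd heven hN0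
  have eT := two_mul_sum_odd_genHarmonic_sub_sq h2 hodd heven hN0 h3
    (oddRecipSum_two_add_evenRecipSum_two hN)
  have hD := digits_reducesTo_zero hS.isPIntegral
  refine ⟨hS.isPIntegral, ?_⟩
  have hL := sum_bernoulli_mul_bernoulli_reducesTo hN
  rw [show 2 * N + 1 - 3 = 2 * N - 2 by omega, Nat.add_sub_cancel,
    show (2 * N - 2) / 2 = N - 1 by omega]
  refine hL.pCongr ?_
  have hH := harmonic_sums_eq (M := N - 1) (by omega)
  rw [Nat.sub_add_cancel (by omega)] at hH
  have hR := (((hD.add ((ReducesTo.ofNat 6).mul hS)).sub ((ReducesTo.ofNat 4).mul (hS.pow 2))).add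
    ((ReducesTo.ofNat 2).mul hT)).sub (ReducesTo.ofNat 3)
  convert hR using 1
  · linear_combination hH
  -- With `σ` the residue of `S`, this is `-3 + 6σ - 4σ^2 + (q^2 + 2) = 1 + q`, given `2σ = 1 + q`.
  · rw [eT]
    linear_combination (-3 + 2 * (∑ m ∈ Finset.range N,
      (oddRecipSum K 1 (m + 1) + evenRecipSum K 1 m)) + (1 + q)) * eS
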